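/- For $k\ge 1$ let $\chi_k$ denote the chi distribution with $k$ degrees of freedom, i.e. the law of $\sqrt{x_1^2+\dots+x_k^2}$ for independent standard normal $x_1,\dots,x_k$. Let $1\le d\le D$. Let $IP$ be a fixed or random $d$-dimensional affine subspace of $\mathbb{R}^D$, with direction $W$ and orthogonal projection $\Pi$ onto $W$. Let the splitter be a random affine hyperplane in $\mathbb{R}^D$ with normal vector $v\sim N(0,I_D)$, where $v$ is independent of $W$. Let $\alpha$ be the dihedral angle between the splitter and $IP$: if $d=D-1$, it is the angle between a normal vector of the splitter and a normal vector of $IP$; otherwise $\alpha=\pi/2-\angle(v,\Pi v)$ (with $\angle(v,0)=\pi/2$). 1. Almost surely $\sin\alpha=\|\Pi v\|/\|v\|$, where $\|\Pi v\|$ has law $\chi_d$ and $\|v\|$ has law $\chi_D$. 2. If $d$ is fixed and $D\to\infty$, then $\sin\alpha$ behaves like $\chi_d/\sqrt{D-\tfrac12}$: $\sqrt{D-\tfrac12}\,\sin\alpha$ converges in distribution to $\chi_d$, and so does $\sqrt{D}\,\sin\alpha$. 3. If $d\to\infty$ and $D\to\infty$ with $d/D\to 0$, then $\sin\alpha$ is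 asymptotically $N\!\left(\frac{\sqrt{d-1/2}}{\sqrt{D-1/2}},\frac1{2D-1}\right)$, i.e. $$\frac{\sin\alpha-\sqrt{d-\frac12}\big/\sqrt{D-\frac12}}{\sqrt{1/(2D-1)}}\longrightarrow N(0,1)\quad\text{in distribution.}$$ -/

import Mathlib

open MeasureTheory ProbabilityTheory Filter Topology

noncomputable section

/-- The chi distribution with `k` degrees of freedom: the law of `√(x₁² + ⋯ + x_k²)` where
`x₁, …, x_k` are independent standard normal variables. -/
def chiMeasure (k : ℕ) : Measure ℝ :=
  (Measure.pi fun _ : Fin k => gaussianReal 0 1).map fun x => √(∑ i, x i ^ 2)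

instance (k : ℕ) : IsProbabilityMeasure (chiMeasure k) :=
  Measure.isProbabilityMeasure_map (Measurable.aemeasurable (by fun_prop))

section Geometry

variable {E : Type*} [NormedAddCommGroup E] [InnerProductSpace ℝ E] [FiniteDimensional ℝ E]

/-- The affine hyperplane through `p` with normal vector `v`. -/
def splitter (p v : E) : AffineSubspace ℝ E :=
  AffineSubspace.mk' p (Submodule.span ℝ {v})ᗮ

/-- `α` is a dihedral angle between the hyperplane `S` and the affine subspace `A`.
If `A` also has codimension one, it is the angle between a normal vector of `S` and a normal
vector of `A` (the two orientations give `α` and `π - α`).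
Otherwise it is `π / 2` minus the angle between a normal vector `m` of `S` and the orthogonal
projection of `m` onto the direction of `A`; if this projection vanishes, then the angle in
question is `π / 2` (the convention of `InnerProductGeometry.angle`), and `α = 0`. -/
def IsDihedralAngle (S A : AffineSubspace ℝ E) (α : ℝ) : Prop :=
  (Module.finrank ℝ A.direction + 1 = Module.finrank ℝ E ∧
    ∃ m ∈ S.directionᗮ, ∃ n ∈ A.directionᗮ, m ≠ 0 ∧ n ≠ 0 ∧
      α = InnerProductGeometry.angle m n) ∨
  (Module.finrank ℝ A.direction + 1 ≠ Module.finrank ℝ E ∧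
    ∃ m ∈ S.directionᗮ, m ≠ 0 ∧
      α = Real.pi / 2 - InnerProductGeometry.angle m (A.direction.starProjection m))

end Geometry

/-- On the probability space `(Ω, P)`, `IP` is a (possibly random) `d`-dimensional affine subspace
of `ℝ^D`, `v ∼ N(0, I_D)` is a normal vector, independent of the direction of `IP`, of a hyperplane
passing through an arbitrary point `p`, and `α` is the dihedral angle of that hyperplane and `IP`.
A random linear subspace is regarded as a random element through its orthogonal projection. -/
structure IsRandomSplit {Ω : Type*} [MeasurableSpace Ω] (P : Measure Ω) (d D : ℕ)
    (IP : Ω → AffineSubspace ℝ (EuclideanSpace ℝ (Fin D)))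
    (p v : Ω → EuclideanSpace ℝ (Fin D)) (α : Ω → ℝ) : Prop where
  finrank_direction : ∀ ω, Module.finrank ℝ (IP ω).direction = d
  aemeasurable_direction : AEMeasurable (fun ω => (IP ω).direction.starProjection) P
  hasLaw_normal : HasLaw v (stdGaussian (EuclideanSpace ℝ (Fin D))) P
  indepFun : IndepFun (fun ω => (IP ω).direction.starProjection) v P
  isDihedralAngle : ∀ᵐ ω ∂P, IsDihedralAngle (splitter (p ω) (v ω)) (IP ω) (α ω)

end

open scoped NNReal

/-!
In both cases of the dihedral angle, `sin α = ‖Πv‖ / ‖v‖`: in codimension one, the direction of the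
affine subspace is the orthogonal complement of its normal. A projection of a standard Gaussian
vector is a standard Gaussian vector of the range, so, conditionally on `W`, the norm `‖Πv‖` has law
`χ_d`, and hence also unconditionally.

The central limit theorem for `x₁² + ⋯ + x_k²` and the delta method for the square root give
Fisher's approximation `χ_k - √(k - a) ⟹ N(0, 1/2)` for every fixed `a`. Put `R = ‖Πv‖`, `S = ‖v‖`,
`B = √(D - a)`, and let `b` be `0` if `d` is fixed and `√(d - a)` if `d → ∞`, so that `b / B → 0`.
Then `B R / S - b = (R - b) B / S + (b / B) · B (B / S - 1)`, where `B / S → 1` in probability and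
`B (B / S - 1)` converges in distribution, so `B R / S - b` has the same limit law as `R - b`. The
variables of different indices live on different probability spaces; they are moved to the product
of these spaces to use convergence in probability.
-/

section Geometry

variable {E : Type*} [NormedAddCommGroup E] [InnerProductSpace ℝ E]

theorem cos_angle_starProjection_mul_norm (K : Submodule ℝ E) [K.HasOrthogonalProjection] (m : E) :
    Real.cos (InnerProductGeometry.angle m (K.starProjection m)) * ‖m‖ =
      ‖K.starProjection m‖ := by
  rcases eq_or_ne ‖K.starProjection m‖ 0 with h | h
  · simp [norm_eq_zero.1 h]
  · have hinner : inner ℝ m (K.starProjection m) = ‖K.starProjection m‖ ^ 2 := by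
      rw [← real_inner_self_eq_norm_sq, Submodule.inner_starProjection_left_eq_right,
        Submodule.starProjection_eq_self_iff.2 (K.starProjection_apply_mem m)]
    refine mul_right_cancel₀ h ?_
    rw [mul_assoc, InnerProductGeometry.cos_angle_mul_norm_mul_norm, hinner, sq]

theorem abs_cos_angle_mul_norm (m n : E) :
    |Real.cos (InnerProductGeometry.angle m n)| * ‖m‖ =
      ‖(Submodule.span ℝ {n}).starProjection m‖ := by
  rcases eq_or_ne n 0 with rfl | hn
  · simp
  · have hn0 : ‖n‖ ≠ 0 := norm_ne_zero_iff.2 hn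
    refine mul_right_cancel₀ hn0 ?_
    calc |Real.cos (InnerProductGeometry.angle m n)| * ‖m‖ * ‖n‖ = |inner ℝ n m| := by
          rw [real_inner_comm, ← InnerProductGeometry.cos_angle_mul_norm_mul_norm, abs_mul,
            abs_of_nonneg (by positivity : 0 ≤ ‖m‖ * ‖n‖), mul_assoc]
      _ = ‖(Submodule.span ℝ {n}).starProjection m‖ * ‖n‖ := by
          rw [Submodule.starProjection_singleton, norm_smul, Real.norm_eq_abs, abs_div]
          simp only [RCLike.ofReal_real_eq_id, id_eq, abs_pow, abs_norm]
          field_simp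

theorem sin_angle_mul_norm (m n : E) :
    Real.sin (InnerProductGeometry.angle m n) * ‖m‖ =
      ‖(Submodule.span ℝ {n})ᗮ.starProjection m‖ := by
  have hsin := InnerProductGeometry.sin_angle_nonneg m n
  rw [← sq_eq_sq₀ (by positivity) (norm_nonneg _), mul_pow, Real.sin_sq, ← sq_abs (Real.cos _)]
  linear_combination Submodule.norm_sq_eq_add_norm_sq_starProjection m (Submodule.span ℝ {n}) -
    congrArg (· ^ 2) (abs_cos_angle_mul_norm m n)

theorem norm_starProjection_div_norm_of_mem_span (K : Submodule ℝ E)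
    [K.HasOrthogonalProjection] {m v : E} (hm : m ∈ Submodule.span ℝ {v})
    (hm0 : m ≠ 0) :
    ‖K.starProjection m‖ / ‖m‖ = ‖K.starProjection v‖ / ‖v‖ := by
  obtain ⟨c, rfl⟩ := Submodule.mem_span_singleton.1 hm
  have hc : ‖c‖ ≠ 0 := norm_ne_zero_iff.2 (smul_ne_zero_iff.1 hm0).1
  rw [map_smul, norm_smul, norm_smul, mul_div_mul_left _ _ hc]

theorem orthogonal_direction_splitter (p v : E) :
    (splitter p v).directionᗮ = Submodule.span ℝ {v} := by
  rw [splitter, AffineSubspace.direction_mk', Submodule.orthogonal_orthogonal]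

variable [FiniteDimensional ℝ E]

theorem eq_orthogonal_span_singleton_of_finrank_add_one_eq {K : Submodule ℝ E} {n : E}
    (hK : Module.finrank ℝ K + 1 = Module.finrank ℝ E) (hn : n ∈ Kᗮ) (hn0 : n ≠ 0) :
    K = (Submodule.span ℝ {n})ᗮ := by
  refine Submodule.eq_of_le_of_finrank_eq ?_ ?_
  · rw [← Submodule.le_orthogonal_iff_le_orthogonal]
    exact (Submodule.span_singleton_le_iff_mem n _).2 hn
  · have := (Submodule.span ℝ {n}).finrank_add_finrank_orthogonal
    rw [finrank_span_singleton hn0] at this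
    lia

theorem IsDihedralAngle.sin_eq {p v : E} {A : AffineSubspace ℝ E} {α : ℝ}
    (h : IsDihedralAngle (splitter p v) A α) :
    Real.sin α = ‖A.direction.starProjection v‖ / ‖v‖ := by
  unfold IsDihedralAngle at h
  rw [orthogonal_direction_splitter] at h
  rcases h with ⟨hA, m, hm, n, hn, hm0, hn0, rfl⟩ | ⟨-, m, hm, hm0, rfl⟩ <;>
    rw [← norm_starProjection_div_norm_of_mem_span _ hm hm0, eq_div_iff (norm_ne_zero_iff.2 hm0)]
  · rw [sin_angle_mul_norm, eq_orthogonal_span_singleton_of_finrank_add_one_eq hA hn hn0]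
  · rw [Real.sin_pi_div_two_sub, cos_angle_starProjection_mul_norm]

end Geometry

section ChiLaw

variable {E : Type*} [NormedAddCommGroup E] [InnerProductSpace ℝ E] [FiniteDimensional ℝ E]
  [MeasurableSpace E] [BorelSpace E]

theorem hasLaw_norm_stdGaussian :
    HasLaw (fun x : E => ‖x‖) (chiMeasure (Module.finrank ℝ E)) (stdGaussian E) where
  map_eq := by
    let b := stdOrthonormalBasis ℝ E
    rw [stdGaussian_eq_map_pi_orthonormalBasis b, Measure.map_map (by fun_prop) (by fun_prop),
      chiMeasure]
    congr with x
    have hcoord (i : Fin (Module.finrank ℝ E)) : inner ℝ (b i) (∑ j, x j • b j) = x i :=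
      b.orthonormal.inner_right_fintype x i
    rw [Function.comp_apply, ← Real.sqrt_sq (norm_nonneg _), ← b.sum_sq_inner_right]
    simp only [hcoord]

theorem hasLaw_orthogonalProjectionOnto_stdGaussian (K : Submodule ℝ E) :
    HasLaw K.orthogonalProjectionOnto (stdGaussian K) (stdGaussian E) where
  map_eq := by
    refine Measure.ext_of_charFun ?_
    ext t
    rw [charFun_apply, integral_map (by fun_prop) (by fun_prop)]
    simp_rw [Submodule.inner_orthogonalProjectionOnto_eq_of_mem_right]
    rw [← charFun_apply, charFun_stdGaussian, charFun_stdGaussian, Submodule.coe_norm]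

theorem hasLaw_norm_starProjection_stdGaussian (K : Submodule ℝ E) :
    HasLaw (fun x => ‖K.starProjection x‖) (chiMeasure (Module.finrank ℝ K)) (stdGaussian E) :=
  hasLaw_norm_stdGaussian.fun_comp (hasLaw_orthogonalProjectionOnto_stdGaussian K)

end ChiLaw

theorem hasLaw_of_indepFun_of_ae_hasLaw {Ω 𝓧 𝓨 𝓩 : Type*} [MeasurableSpace Ω]
    [MeasurableSpace 𝓧] [MeasurableSpace 𝓨] [MeasurableSpace 𝓩] {P : Measure Ω}
    [IsProbabilityMeasure P] {X : Ω → 𝓧} {Y : Ω → 𝓨} {F : 𝓧 × 𝓨 → 𝓩} {μ : Measure 𝓨}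
    {ρ : Measure 𝓩} (hX : AEMeasurable X P) (hY : HasLaw Y μ P) (hXY : IndepFun X Y P)
    (hF : Measurable F) (h : ∀ᵐ ω ∂P, HasLaw (fun y => F (X ω, y)) ρ μ) :
    HasLaw (fun ω => F (X ω, Y ω)) ρ P where
  aemeasurable := hF.comp_aemeasurable (hX.prodMk hY.aemeasurable)
  map_eq := by
    have := hY.isProbabilityMeasure_iff.1 ‹_›
    have hprod := (indepFun_iff_hasLaw_prodMk_prod ⟨hX, rfl⟩ hY).1 hXY
    ext s hs
    calc P.map (fun ω => F (X ω, Y ω)) s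
        = ((P.map X).prod μ) (F ⁻¹' s) := by
          rw [← hprod.map_eq, ← Measure.map_apply hF hs,
            AEMeasurable.map_map_of_aemeasurable hF.aemeasurable hprod.aemeasurable]
          rfl
      _ = ∫⁻ ω, μ (Prod.mk (X ω) ⁻¹' (F ⁻¹' s)) ∂P := by
          rw [Measure.prod_apply (hF hs),
            lintegral_map' (measurable_measure_prodMk_left (hF hs)).aemeasurable hX]
      _ = ∫⁻ _, ρ s ∂P := by
          refine lintegral_congr_ae (h.mono fun ω hω => ?_)
          rw [← hω.map_eq, Measure.map_apply_of_aemeasurable hω.aemeasurable hs]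
          rfl
      _ = ρ s := by simp

namespace IsRandomSplit

variable {Ω : Type*} [MeasurableSpace Ω] {P : Measure Ω} {d D : ℕ}
  {IP : Ω → AffineSubspace ℝ (EuclideanSpace ℝ (Fin D))}
  {p v : Ω → EuclideanSpace ℝ (Fin D)} {α : Ω → ℝ}

theorem hasLaw_norm_starProjection (h : IsRandomSplit P d D IP p v α) :
    HasLaw (fun ω => ‖(IP ω).direction.starProjection (v ω)‖) (chiMeasure d) P := by
  have := h.hasLaw_normal.isProbabilityMeasure
  have hF : Measurable fun q : (EuclideanSpace ℝ (Fin D) →L[ℝ] EuclideanSpace ℝ (Fin D)) ×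
      EuclideanSpace ℝ (Fin D) => ‖q.1 q.2‖ := Continuous.measurable (by fun_prop)
  refine hasLaw_of_indepFun_of_ae_hasLaw h.aemeasurable_direction h.hasLaw_normal h.indepFun hF
    (ae_of_all _ fun ω => ?_)
  rw [← h.finrank_direction ω]
  exact hasLaw_norm_starProjection_stdGaussian _

theorem hasLaw_norm (h : IsRandomSplit P d D IP p v α) :
    HasLaw (fun ω => ‖v ω‖) (chiMeasure D) P := by
  simpa using hasLaw_norm_stdGaussian.fun_comp h.hasLaw_normal

theorem ae_sin_eq (h : IsRandomSplit P d D IP p v α) :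
    ∀ᵐ ω ∂P, Real.sin (α ω) = ‖(IP ω).direction.starProjection (v ω)‖ / ‖v ω‖ :=
  h.isDihedralAngle.mono fun _ hω => hω.sin_eq

theorem aemeasurable_sin (h : IsRandomSplit P d D IP p v α) :
    AEMeasurable (fun ω => Real.sin (α ω)) P :=
  (h.hasLaw_norm_starProjection.aemeasurable.div h.hasLaw_norm.aemeasurable).congr
    (h.ae_sin_eq.mono fun _ hω => hω.symm)

end IsRandomSplit

section Convergence

variable {ι : Type*} {l : Filter ι}

section Laws

variable {E Ω₁ Ω₁' : Type*} {Ω Ω' : ι → Type*}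
  {m : ∀ i, MeasurableSpace (Ω i)} {μ : ∀ i, Measure (Ω i)} [∀ i, IsProbabilityMeasure (μ i)]
  {m' : ∀ i, MeasurableSpace (Ω' i)} {μ' : ∀ i, Measure (Ω' i)} [∀ i, IsProbabilityMeasure (μ' i)]
  {m₁ : MeasurableSpace Ω₁} {ν : Measure Ω₁} [IsProbabilityMeasure ν]
  {m₁' : MeasurableSpace Ω₁'} {ν' : Measure Ω₁'} [IsProbabilityMeasure ν']
  [TopologicalSpace E] [MeasurableSpace E] [OpensMeasurableSpace E]
  {X : ∀ i, Ω i → E} {Y : ∀ i, Ω' i → E} {Z : Ω₁ → E} {T : Ω₁' → E}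

theorem tendstoInDistribution_of_eventually_identDistrib (h : TendstoInDistribution X l Z μ ν)
    (hY : ∀ i, AEMeasurable (Y i) (μ' i))
    (hXY : ∀ᶠ i in l, IdentDistrib (X i) (Y i) (μ i) (μ' i)) (hZT : IdentDistrib Z T ν ν') :
    TendstoInDistribution Y l T μ' ν' where
  forall_aemeasurable := hY
  aemeasurable_limit := hZT.aemeasurable_snd
  tendsto := by
    have hlim : (⟨ν'.map T, Measure.isProbabilityMeasure_map hZT.aemeasurable_snd⟩ :
        ProbabilityMeasure E) = ⟨ν.map Z, Measure.isProbabilityMeasure_map h.aemeasurable_limit⟩ :=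
      Subtype.ext hZT.map_eq.symm
    rw [hlim]
    refine h.tendsto.congr' (hXY.mono fun i hi => ?_)
    exact Subtype.ext hi.map_eq

theorem tendstoInDistribution_congr' {Y : ∀ i, Ω i → E} (h : TendstoInDistribution X l Z μ ν)
    (hY : ∀ i, AEMeasurable (Y i) (μ i)) (hXY : ∀ᶠ i in l, X i = Y i) :
    TendstoInDistribution Y l Z μ ν :=
  tendstoInDistribution_of_eventually_identDistrib h hY
    (hXY.mono fun i hi => hi ▸ .refl (h.forall_aemeasurable i)) (.refl h.aemeasurable_limit)

theorem tendstoInDistribution_infinitePi_iff (hX : ∀ i, AEMeasurable (X i) (μ i)) :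
    TendstoInDistribution (fun i ω => X i (ω i)) l Z (fun _ => Measure.infinitePi μ) ν ↔
      TendstoInDistribution X l Z μ ν := by
  have hident (i : ι) :
      IdentDistrib (X i) (fun ω : ∀ i, Ω i => X i (ω i)) (μ i) (Measure.infinitePi μ) :=
    have hlaw : HasLaw (X i) ((μ i).map (X i)) (μ i) := ⟨hX i, rfl⟩
    hlaw.identDistrib (hlaw.fun_comp (measurePreserving_eval_infinitePi μ i).hasLaw)
  exact ⟨fun h => tendstoInDistribution_of_eventually_identDistrib h hX
      (.of_forall fun i => (hident i).symm) (.refl h.aemeasurable_limit),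
    fun h => tendstoInDistribution_of_eventually_identDistrib h
      (fun i => (hident i).aemeasurable_snd) (.of_forall hident) (.refl h.aemeasurable_limit)⟩

end Laws

theorem tendstoInMeasure_comp_const_of_continuousAt {E F Ω : Type*} [PseudoMetricSpace E]
    [PseudoMetricSpace F] {m : MeasurableSpace Ω} {μ : Measure Ω} {X : ι → Ω → E} {g : E → F}
    {c : E} (hX : TendstoInMeasure μ X l fun _ => c) (hg : ContinuousAt g c) :
    TendstoInMeasure μ (fun i ω => g (X i ω)) l fun _ => g c := by
  rw [tendstoInMeasure_iff_dist] at hX ⊢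
  intro ε hε
  obtain ⟨δ, hδ, hgδ⟩ := Metric.continuousAt_iff.1 hg ε hε
  refine tendsto_of_tendsto_of_tendsto_of_le_of_le tendsto_const_nhds (hX δ hδ)
    (fun _ => zero_le) fun i => measure_mono fun ω hω => ?_
  contrapose! hω
  exact not_le.2 (hgδ (not_le.1 hω))

variable {Ω Ω' Ω'' : Type*} {m : MeasurableSpace Ω} {μ : Measure Ω} [IsProbabilityMeasure μ]
  {m' : MeasurableSpace Ω'} {ν : Measure Ω'} [IsProbabilityMeasure ν]
  {m'' : MeasurableSpace Ω''} {ρ : Measure Ω''} [IsProbabilityMeasure ρ]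

theorem tendstoInMeasure_of_tendstoInDistribution_const {E : Type*} [PseudoMetricSpace E]
    [MeasurableSpace E] [OpensMeasurableSpace E] {X : ι → Ω → E} {c : E}
    (h : TendstoInDistribution X l (fun _ : Ω' => c) (fun _ => μ) ν) :
    TendstoInMeasure μ X l fun _ => c := by
  rw [tendstoInMeasure_iff_dist]
  intro ε hε
  have hcl : IsClosed {x : E | ε ≤ dist x c} := isClosed_le continuous_const (by fun_prop)
  have hlim := ProbabilityMeasure.limsup_measure_closed_le_of_tendsto h.tendsto hcl
  have hnull : ν.map (fun _ => c) {x : E | ε ≤ dist x c} = 0 := by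
    rw [Measure.map_apply measurable_const hcl.measurableSet]
    simp [hε.not_ge]
  simp only [ProbabilityMeasure.coe_mk, hnull] at hlim
  refine tendsto_of_le_liminf_of_limsup_le zero_le (hlim.trans_eq' (limsup_congr ?_))
  refine .of_forall fun i => ?_
  rw [Measure.map_apply_of_aemeasurable (h.forall_aemeasurable i) hcl.measurableSet]
  rfl

variable [l.IsCountablyGenerated]

theorem tendstoInMeasure_of_tendsto {E : Type*} [PseudoMetricSpace E] [MeasurableSpace E]
    [OpensMeasurableSpace E] {a : ι → E} {c : E} (ha : Tendsto a l (𝓝 c)) :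
    TendstoInMeasure μ (fun i _ => a i) l fun _ => c :=
  tendstoInMeasure_of_tendstoInDistribution_const <| tendstoInDistribution_of_ae_tendsto
    (fun _ => aemeasurable_const) aemeasurable_const (ae_of_all μ fun _ => ha)

theorem tendstoInMeasure_mul_of_tendsto_zero {X : ι → Ω → ℝ} {Z : Ω' → ℝ} {a : ι → ℝ}
    (hX : TendstoInDistribution X l Z (fun _ => μ) ν) (ha : Tendsto a l (𝓝 0)) :
    TendstoInMeasure μ (fun i ω => a i * X i ω) l fun _ => 0 := by
  refine tendstoInMeasure_of_tendstoInDistribution_const (ν := ν) ?_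
  simpa using hX.continuous_comp_prodMk_of_tendstoInMeasure_const (g := fun q => q.2 * q.1)
    (by fun_prop) (tendstoInMeasure_of_tendsto ha) (fun _ => by fun_prop)

theorem tendstoInMeasure_of_tendstoInDistribution_mul_sub {X : ι → Ω → ℝ} {Z : Ω' → ℝ}
    {r : ι → ℝ} {c : ℝ} (hr : Tendsto r l atTop)
    (hX : TendstoInDistribution (fun i ω => r i * (X i ω - c)) l Z (fun _ => μ) ν) :
    TendstoInMeasure μ X l fun _ => c := by
  have hsub := tendstoInMeasure_mul_of_tendsto_zero hX hr.inv_tendsto_atTop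
  have hadd := tendstoInMeasure_comp_const_of_continuousAt (g := (· + c)) hsub (by fun_prop)
  simp only [zero_add] at hadd
  refine hadd.congr' ?_ .rfl
  filter_upwards [hr.eventually_ne_atTop 0] with i hi
  refine .of_forall fun ω => ?_
  simp [hi]

theorem measurable_dslope {f : ℝ → ℝ} (hf : Measurable f) (c : ℝ) : Measurable (dslope f c) := by
  have h : dslope f c = fun x => if x = c then deriv f c else (x - c)⁻¹ * (f x - f c) := by
    ext x
    simp [dslope, Function.update_apply, slope]
  rw [h]
  exact Measurable.ite (measurableSet_singleton c) (by fun_prop) (by fun_prop)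

-- The delta method: Slutsky's theorem applied to `f x - f c = (x - c) * dslope f c x`.
theorem tendstoInDistribution_mul_comp_sub_of_hasDerivAt {X : ι → Ω → ℝ} {Z : Ω' → ℝ}
    {r : ι → ℝ} {f : ℝ → ℝ} {f' c : ℝ} (hr : Tendsto r l atTop)
    (hXm : ∀ i, AEMeasurable (X i) μ)
    (hX : TendstoInDistribution (fun i ω => r i * (X i ω - c)) l Z (fun _ => μ) ν)
    (hfm : Measurable f) (hf : HasDerivAt f f' c) :
    TendstoInDistribution (fun i ω => r i * (f (X i ω) - f c)) l (fun ω => Z ω * f')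
      (fun _ => μ) ν := by
  have hslope_meas := measurable_dslope hfm c
  have hslope : TendstoInMeasure μ (fun i ω => dslope f c (X i ω)) l fun _ => f' := by
    rw [← hf.deriv, ← dslope_same]
    exact tendstoInMeasure_comp_const_of_continuousAt
      (tendstoInMeasure_of_tendstoInDistribution_mul_sub hr hX)
      (continuousAt_dslope_same.2 hf.differentiableAt)
  convert hX.continuous_comp_prodMk_of_tendstoInMeasure_const (g := fun q => q.1 * q.2)
    (by fun_prop) hslope (fun i => by fun_prop) using 3 with i ω
  rw [mul_assoc, ← smul_eq_mul (X i ω - c), sub_smul_dslope]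

theorem tendstoInDistribution_mul_div_sub_of_common_space {R S : ι → Ω → ℝ} {Z : Ω' → ℝ}
    {W : Ω'' → ℝ} {b B : ι → ℝ}
    (hR : TendstoInDistribution (fun i ω => R i ω - b i) l Z (fun _ => μ) ν)
    (hS : TendstoInDistribution (fun i ω => S i ω - B i) l W (fun _ => μ) ρ)
    (hB : Tendsto B l atTop) (hbB : Tendsto (fun i => b i / B i) l (𝓝 0)) :
    TendstoInDistribution (fun i ω => B i * (R i ω / S i ω) - b i) l Z (fun _ => μ) ν := by
  have hRm (i : ι) : AEMeasurable (R i) μ := by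
    simpa using (hR.forall_aemeasurable i).add_const (b i)
  have hSm (i : ι) : AEMeasurable (S i) μ := by
    simpa using (hS.forall_aemeasurable i).add_const (B i)
  have hB0 := hB.eventually_ne_atTop 0
  have hS' : TendstoInDistribution (fun i ω => B i * (S i ω / B i - 1)) l W (fun _ => μ) ρ := by
    refine tendstoInDistribution_congr' hS (fun i => by fun_prop) (hB0.mono fun i hi => ?_)
    ext ω
    field_simp
  have hinv : TendstoInDistribution (fun i ω => B i * ((S i ω / B i)⁻¹ - 1)) l
      (fun ω => W ω * -1) (fun _ => μ) ρ := by
    simpa using tendstoInDistribution_mul_comp_sub_of_hasDerivAt hB (fun i => by fun_prop) hS'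
      measurable_inv (hasDerivAt_inv one_ne_zero)
  have hmain := hR.continuous_comp_prodMk_of_tendstoInMeasure_const (g := fun q => q.1 * q.2)
    (by fun_prop) (tendstoInMeasure_of_tendstoInDistribution_mul_sub hB hinv)
    (fun i => by fun_prop)
  have hsum := hmain.add_of_tendstoInMeasure_const
    (tendstoInMeasure_mul_of_tendsto_zero hinv hbB) (fun i => by fun_prop)
  simp only [mul_one, add_zero] at hsum
  refine tendstoInDistribution_congr' hsum (fun i => by fun_prop) (hB0.mono fun i hi => ?_)
  ext ω
  simp only [Pi.add_apply, inv_div]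
  rw [← mul_assoc, div_mul_cancel₀ _ hi]
  ring

theorem tendstoInDistribution_mul_div_sub {Ω : ι → Type*} {m : ∀ i, MeasurableSpace (Ω i)}
    {μ : ∀ i, Measure (Ω i)} [∀ i, IsProbabilityMeasure (μ i)] {R S : ∀ i, Ω i → ℝ}
    {Z : Ω' → ℝ} {W : Ω'' → ℝ} {b B : ι → ℝ}
    (hR : TendstoInDistribution (fun i ω => R i ω - b i) l Z μ ν)
    (hS : TendstoInDistribution (fun i ω => S i ω - B i) l W μ ρ)
    (hB : Tendsto B l atTop) (hbB : Tendsto (fun i => b i / B i) l (𝓝 0)) :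
    TendstoInDistribution (fun i ω => B i * (R i ω / S i ω) - b i) l Z μ ν := by
  have hRm (i : ι) : AEMeasurable (R i) (μ i) := by
    simpa using (hR.forall_aemeasurable i).add_const (b i)
  have hSm (i : ι) : AEMeasurable (S i) (μ i) := by
    simpa using (hS.forall_aemeasurable i).add_const (B i)
  rw [← tendstoInDistribution_infinitePi_iff (fun i => by fun_prop)] at hR hS ⊢
  exact tendstoInDistribution_mul_div_sub_of_common_space hR hS hB hbB

end Convergence

section ChiAsymptotics

theorem integral_pow_add_two_gaussianReal (v : ℝ≥0) (n : ℕ) :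
    ∫ x, x ^ (n + 2) ∂gaussianReal 0 v = (n + 1) * v * ∫ x, x ^ n ∂gaussianReal 0 v := by
  let M (t : ℝ) : ℝ := Real.exp (v * t ^ 2 / 2)
  have hmoment (k : ℕ) : ∫ x, x ^ k ∂gaussianReal 0 v = iteratedDeriv k M 0 := by
    have h := iteratedDeriv_mgf_zero (X := fun x : ℝ => x) (μ := gaussianReal 0 v) (by simp) k
    simp only [mgf_fun_id_gaussianReal, zero_mul, zero_add] at h
    exact h.symm
  have hderiv : deriv M = fun t => v * (t * M t) := by
    ext t
    have hexponent : HasDerivAt (fun t : ℝ => v * t ^ 2 / 2) (v * t) t := by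
      refine (((hasDerivAt_pow 2 t).const_mul (v : ℝ)).div_const 2).congr_deriv ?_
      push_cast
      ring
    rw [hexponent.exp.deriv]
    ring
  have hM : ContDiff ℝ (n + 1 : ℕ) M := by fun_prop
  rw [hmoment, hmoment, iteratedDeriv_succ', hderiv, iteratedDeriv_const_mul_field,
    iteratedDeriv_fun_mul (by fun_prop) hM.contDiffAt]
  simp only [iteratedDeriv_fun_id_zero, mul_ite, mul_one, mul_zero, ite_mul, zero_mul,
    Finset.sum_ite_eq', Finset.mem_range, lt_add_iff_pos_left, Order.lt_add_one_iff, zero_le,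
    ↓reduceIte, Nat.choose_one_right, Nat.cast_add, Nat.cast_one, add_tsub_cancel_right]
  ring

theorem integral_sq_gaussianReal (v : ℝ≥0) : ∫ x, x ^ 2 ∂gaussianReal 0 v = v := by
  simpa using integral_pow_add_two_gaussianReal v 0

theorem memLp_sq_gaussianReal (v : ℝ≥0) : MemLp (fun x => x ^ 2) 2 (gaussianReal 0 v) := by
  rw [memLp_two_iff_integrable_sq (by fun_prop)]
  simp_rw [← pow_mul]
  exact integrable_pow_of_mem_interior_integrableExpSet (X := fun x : ℝ => x) (by simp) _

theorem variance_sq_gaussianReal (v : ℝ≥0) :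
    Var[fun x => x ^ 2; gaussianReal 0 v] = 2 * v ^ 2 := by
  have hfour : ∫ x, x ^ 4 ∂gaussianReal 0 v = 3 * v ^ 2 := by
    rw [integral_pow_add_two_gaussianReal, integral_sq_gaussianReal]
    push_cast
    ring
  rw [variance_eq_sub (memLp_sq_gaussianReal v), integral_sq_gaussianReal]
  simp only [Pi.pow_apply, ← pow_mul]
  rw [hfour]
  ring

theorem hasLaw_mul_const_gaussianReal {v w : ℝ≥0} {c : ℝ} (hc : c ^ 2 * v = w) :
    HasLaw (fun x => x * c) (gaussianReal 0 w) (gaussianReal 0 v) := by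
  have hw : w = .mk (c ^ 2) (sq_nonneg c) * v := NNReal.eq hc.symm
  simpa [hw] using gaussianReal_mul_const (HasLaw.id (μ := gaussianReal 0 v)) c

theorem tendsto_sqrt_sub_sqrt_sub (a : ℝ) :
    Tendsto (fun x : ℝ => √x - √(x - a)) atTop (𝓝 0) := by
  have hdenom : Tendsto (fun x : ℝ => √x + √(x - a)) atTop atTop :=
    Real.tendsto_sqrt_atTop.atTop_add_nonneg fun _ => Real.sqrt_nonneg _
  refine (tendsto_const_nhds (x := a).div_atTop hdenom).congr' ?_
  filter_upwards [eventually_gt_atTop 0, eventually_ge_atTop a] with x hx hxa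
  have hpos : 0 < √x + √(x - a) := by positivity
  rw [div_eq_iff hpos.ne']
  linear_combination Real.sq_sqrt (sub_nonneg.2 hxa) - Real.sq_sqrt hx.le

section IID

variable {Ω : Type*} [MeasurableSpace Ω] {P : Measure Ω} {X : ℕ → Ω → ℝ}

theorem hasLaw_sqrt_sum_sq_chiMeasure (hX : ∀ i, HasLaw (X i) (gaussianReal 0 1) P)
    (hindep : iIndepFun X P) (k : ℕ) :
    HasLaw (fun ω => √(∑ i ∈ Finset.range k, X i ω ^ 2)) (chiMeasure k) P := by
  have hchi : HasLaw (fun x : Fin k → ℝ => √(∑ i, x i ^ 2)) (chiMeasure k)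
      (Measure.pi fun _ => gaussianReal 0 1) := ⟨Measurable.aemeasurable (by fun_prop), rfl⟩
  simpa only [Finset.sum_range] using
    hchi.fun_comp ((hindep.precomp Fin.val_injective).hasLaw_pi fun i : Fin k => hX i)

variable [IsProbabilityMeasure P]

theorem tendstoInDistribution_sqrt_mul_sum_sq_div_sub_one
    (hX : ∀ i, HasLaw (X i) (gaussianReal 0 1) P) (hindep : iIndepFun X P) :
    TendstoInDistribution
      (fun (k : ℕ) ω => √k * ((∑ i ∈ Finset.range k, X i ω ^ 2) / k - 1)) atTop id
      (fun _ => P) (gaussianReal 0 2) := by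
  have hsq (i : ℕ) : IdentDistrib (fun ω => X i ω ^ 2) (fun x => x ^ 2) P (gaussianReal 0 1) :=
    ((hX i).identDistrib .id).comp (u := fun x => x ^ 2) (by fun_prop)
  have hvar : Var[fun ω => X 0 ω ^ 2; P] = 2 := by
    rw [(hsq 0).variance_eq, variance_sq_gaussianReal]
    simp
  have hmean : ∫ ω, X 0 ω ^ 2 ∂P = 1 := by
    rw [(hsq 0).integral_eq, integral_sq_gaussianReal, NNReal.coe_one]
  have hclt := tendstoInDistribution_inv_sqrt_mul_sum_sub (X := fun i ω => X i ω ^ 2) (Y := id)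
    (P' := gaussianReal 0 2) (by simpa [hvar] using HasLaw.id)
    ((hsq 0).memLp_iff.2 (memLp_sq_gaussianReal 1))
    (hindep.comp (fun _ x => x ^ 2) fun _ => by fun_prop) fun i => (hsq i).trans (hsq 0).symm
  convert hclt using 3 with k ω
  rcases eq_or_ne k 0 with rfl | hk
  · simp
  · rw [hmean, mul_one]
    have hsqrt : √(k : ℝ) ^ 2 = k := Real.sq_sqrt k.cast_nonneg
    have : (0 : ℝ) < √k := by positivity
    field_simp
    rw [hsqrt]

theorem tendstoInDistribution_sqrt_sum_sq_sub_sqrt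
    (hX : ∀ i, HasLaw (X i) (gaussianReal 0 1) P) (hindep : iIndepFun X P) :
    TendstoInDistribution (fun (k : ℕ) ω => √(∑ i ∈ Finset.range k, X i ω ^ 2) - √k) atTop id
      (fun _ => P) (gaussianReal 0 2⁻¹) := by
  have hXm (i : ℕ) : AEMeasurable (X i) P := (hX i).aemeasurable
  have hsqrt : HasDerivAt Real.sqrt 2⁻¹ 1 := by
    simpa using Real.hasDerivAt_sqrt one_ne_zero
  have hdelta := tendstoInDistribution_mul_comp_sub_of_hasDerivAt
    (Real.tendsto_sqrt_atTop.comp tendsto_natCast_atTop_atTop) (fun k => by fun_prop)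
    (tendstoInDistribution_sqrt_mul_sum_sq_div_sub_one hX hindep) (by fun_prop) hsqrt
  refine tendstoInDistribution_of_eventually_identDistrib hdelta (fun k => by fun_prop) ?_ ?_
  · filter_upwards [eventually_ne_atTop 0] with k hk
    refine .of_ae_eq (hdelta.forall_aemeasurable k) (ae_of_all _ fun ω => ?_)
    have hk0 : √(k : ℝ) ≠ 0 := by positivity
    simp only [Function.comp_apply, Nat.cast_nonneg, Real.sqrt_div', Real.sqrt_one]
    field_simp
  · exact (hasLaw_mul_const_gaussianReal (by norm_num)).identDistrib .id

end IID

theorem tendstoInDistribution_sub_sqrt_chiMeasure (a : ℝ) :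
    TendstoInDistribution (fun (k : ℕ) x => x - √((k : ℝ) - a)) atTop id chiMeasure
      (gaussianReal 0 2⁻¹) := by
  obtain ⟨Ω, _, P, X, -, hX, hindep, _⟩ := exists_iid ℕ (gaussianReal 0 1)
  have hsub := (tendsto_sqrt_sub_sqrt_sub a).comp tendsto_natCast_atTop_atTop
  have hsum := (tendstoInDistribution_sqrt_sum_sq_sub_sqrt hX hindep).add_of_tendstoInMeasure_const
    (tendstoInMeasure_of_tendsto hsub) (fun k => by fun_prop)
  refine tendstoInDistribution_of_eventually_identDistrib hsum (fun k => by fun_prop)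
    (.of_forall fun k => ?_) (by simpa using .refl aemeasurable_id)
  have hident := (hasLaw_sqrt_sum_sq_chiMeasure hX hindep k).identDistrib .id
  convert hident.comp (u := fun x => x - √((k : ℝ) - a)) (by fun_prop) using 1
  · ext ω
    simp
  · rfl

theorem tendstoInDistribution_sub_sqrt_of_hasLaw_chiMeasure {ι : Type*} {l : Filter ι}
    {Ω : ι → Type*} [∀ i, MeasurableSpace (Ω i)] {P : ∀ i, Measure (Ω i)}
    [∀ i, IsProbabilityMeasure (P i)] {R : ∀ i, Ω i → ℝ} {k : ι → ℕ}
    (hR : ∀ i, HasLaw (R i) (chiMeasure (k i)) (P i)) (hk : Tendsto k l atTop) (a : ℝ) :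
    TendstoInDistribution (fun i ω => R i ω - √((k i : ℝ) - a)) l id P (gaussianReal 0 2⁻¹) := by
  have hchi := tendstoInDistribution_sub_sqrt_chiMeasure a
  have hcomp : TendstoInDistribution (fun i x => x - √((k i : ℝ) - a)) l id
      (fun i => chiMeasure (k i)) (gaussianReal 0 2⁻¹) :=
    ⟨fun i => by fun_prop, by fun_prop, hchi.tendsto.comp hk⟩
  refine tendstoInDistribution_of_eventually_identDistrib hcomp (fun i => ?_)
    (.of_forall fun i => ?_) (.refl aemeasurable_id)
  · exact (hR i).aemeasurable.sub_const _
  · exact (HasLaw.id.identDistrib (hR i)).comp (u := fun x => x - √((k i : ℝ) - a)) (by fun_prop)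

end ChiAsymptotics

theorem tendsto_sqrt_sub_div_sqrt_sub {ι : Type*} {l : Filter ι} {x y : ι → ℝ} (a b : ℝ)
    (hy : Tendsto y l atTop) (hxy : Tendsto (fun i => x i / y i) l (𝓝 0)) :
    Tendsto (fun i => √(x i - a) / √(y i - b)) l (𝓝 0) := by
  have hquot : Tendsto (fun i => (x i / y i - a / y i) / (1 - b / y i)) l (𝓝 0) := by
    simpa [Pi.div_def] using
      (hxy.sub (hy.const_div_atTop a)).div ((hy.const_div_atTop b).const_sub 1) (by simp)
  have hsqrt := hquot.sqrt
  rw [Real.sqrt_zero] at hsqrt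
  refine hsqrt.congr' ?_
  filter_upwards [hy.eventually_gt_atTop 0, hy.eventually_ge_atTop b] with i hpos hb
  rw [← Real.sqrt_div' _ (sub_nonneg.2 hb)]
  congr 1
  field_simp

theorem sub_div_sqrt_div_sqrt_one_div (s b : ℝ) {y : ℝ} (hy : 1 / 2 < y) :
    (s - b / √(y - 1 / 2)) / √(1 / (2 * y - 1)) = (√(y - 1 / 2) * s - b) * √2 := by
  have hscale : √(1 / (2 * y - 1)) = 1 / (√2 * √(y - 1 / 2)) := by
    rw [← Real.sqrt_mul zero_le_two, Real.sqrt_div zero_le_one, Real.sqrt_one]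
    ring_nf
  have hpos : 0 < √(y - 1 / 2) := Real.sqrt_pos.2 (sub_pos.2 hy)
  rw [hscale]
  generalize √(y - 1 / 2) = B at hpos ⊢
  field_simp

section RandomSplit

variable {ι : Type*} {l : Filter ι} [l.IsCountablyGenerated] {Ω : ι → Type*}
  [∀ i, MeasurableSpace (Ω i)] {P : ∀ i, Measure (Ω i)} [∀ i, IsProbabilityMeasure (P i)]
  {D : ι → ℕ} {IP : ∀ i, Ω i → AffineSubspace ℝ (EuclideanSpace ℝ (Fin (D i)))}
  {p v : ∀ i, Ω i → EuclideanSpace ℝ (Fin (D i))} {α : ∀ i, Ω i → ℝ}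

theorem tendstoInDistribution_sqrt_mul_sin_sub {Ω' : Type*} {_ : MeasurableSpace Ω'}
    {ν : Measure Ω'} [IsProbabilityMeasure ν] {Z : Ω' → ℝ} {d : ι → ℕ} {b : ι → ℝ} (a : ℝ)
    (h : ∀ i, IsRandomSplit (P i) (d i) (D i) (IP i) (p i) (v i) (α i)) (hD : Tendsto D l atTop)
    (hb : Tendsto (fun i => b i / √((D i : ℝ) - a)) l (𝓝 0))
    (hR : TendstoInDistribution
      (fun i ω => ‖(IP i ω).direction.starProjection (v i ω)‖ - b i) l Z P ν) :
    TendstoInDistribution (fun i ω => √((D i : ℝ) - a) * Real.sin (α i ω) - b i) l Z P ν := by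
  have hS := tendstoInDistribution_sub_sqrt_of_hasLaw_chiMeasure (fun i => (h i).hasLaw_norm) hD a
  have hB : Tendsto (fun i => √((D i : ℝ) - a)) l atTop :=
    Real.tendsto_sqrt_atTop.comp <|
      tendsto_atTop_add_const_right _ (-a) (tendsto_natCast_atTop_atTop.comp hD)
  refine (tendstoInDistribution_mul_div_sub hR hS hB hb).congr (fun i => ?_) .rfl
  filter_upwards [(h i).ae_sin_eq] with ω hω
  rw [hω]

theorem tendstoInDistribution_sqrt_mul_sin {d : ℕ} (a : ℝ)
    (h : ∀ i, IsRandomSplit (P i) d (D i) (IP i) (p i) (v i) (α i)) (hD : Tendsto D l atTop) :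
    TendstoInDistribution (fun i ω => √((D i : ℝ) - a) * Real.sin (α i ω)) l id P
      (chiMeasure d) := by
  have hR : TendstoInDistribution
      (fun i ω => ‖(IP i ω).direction.starProjection (v i ω)‖) l id P (chiMeasure d) :=
    tendstoInDistribution_of_eventually_identDistrib
      (tendstoInDistribution_const (aemeasurable_id (μ := chiMeasure d)))
      (fun i => (h i).hasLaw_norm_starProjection.aemeasurable)
      (.of_forall fun i => HasLaw.id.identDistrib (h i).hasLaw_norm_starProjection)
      (.refl aemeasurable_id)
  simpa using tendstoInDistribution_sqrt_mul_sin_sub (b := fun _ => 0) a h hD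
    (by simpa using tendsto_const_nhds) (by simpa using hR)

theorem tendstoInDistribution_sin_sub_div {d : ι → ℕ}
    (h : ∀ i, IsRandomSplit (P i) (d i) (D i) (IP i) (p i) (v i) (α i)) (hd : Tendsto d l atTop)
    (hD : Tendsto D l atTop) (hdD : Tendsto (fun i => (d i : ℝ) / (D i : ℝ)) l (𝓝 0)) :
    TendstoInDistribution
      (fun i ω => (Real.sin (α i ω) - √((d i : ℝ) - 1 / 2) / √((D i : ℝ) - 1 / 2)) /
        √(1 / (2 * (D i : ℝ) - 1))) l id P (gaussianReal 0 1) := by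
  have hDreal : Tendsto (fun i => (D i : ℝ)) l atTop := tendsto_natCast_atTop_atTop.comp hD
  have hmain := tendstoInDistribution_sqrt_mul_sin_sub (1 / 2) h hD
    (tendsto_sqrt_sub_div_sqrt_sub (1 / 2) (1 / 2) hDreal hdD)
    (tendstoInDistribution_sub_sqrt_of_hasLaw_chiMeasure
      (fun i => (h i).hasLaw_norm_starProjection) hd (1 / 2))
  have hscaled := hmain.continuous_comp (g := fun x => x * √2) (by fun_prop)
  refine tendstoInDistribution_of_eventually_identDistrib hscaled
    (fun i => ((h i).aemeasurable_sin.sub_const _).div_const _) ?_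
    ((hasLaw_mul_const_gaussianReal (by norm_num)).identDistrib .id)
  filter_upwards [hDreal.eventually_gt_atTop (1 / 2)] with i hi
  exact .of_ae_eq (hscaled.forall_aemeasurable i)
    (ae_of_all _ fun ω => (sub_div_sqrt_div_sqrt_one_div _ _ hi).symm)

end RandomSplit

theorem theorem1 :
    -- `sin α` is the quotient of a `χ_d` variable and a `χ_D` variable
    (∀ (d D : ℕ) (Ω : Type*) [MeasurableSpace Ω] (P : Measure Ω) [IsProbabilityMeasure P]
        (IP : Ω → AffineSubspace ℝ (EuclideanSpace ℝ (Fin D)))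
        (p v : Ω → EuclideanSpace ℝ (Fin D)) (α : Ω → ℝ),
        1 ≤ d → IsRandomSplit P d D IP p v α →
        HasLaw (fun ω => ‖(IP ω).direction.starProjection (v ω)‖) (chiMeasure d) P ∧
        HasLaw (fun ω => ‖v ω‖) (chiMeasure D) P ∧
        ∀ᵐ ω ∂P, Real.sin (α ω) = ‖(IP ω).direction.starProjection (v ω)‖ / ‖v ω‖) ∧
    -- `d` fixed, `D → ∞`
    (∀ (d : ℕ) (D : ℕ → ℕ) (Ω : ℕ → Type*) [∀ n, MeasurableSpace (Ω n)]
        (P : ∀ n, Measure (Ω n)) [∀ n, IsProbabilityMeasure (P n)]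
        (IP : ∀ n, Ω n → AffineSubspace ℝ (EuclideanSpace ℝ (Fin (D n))))
        (p v : ∀ n, Ω n → EuclideanSpace ℝ (Fin (D n))) (α : ∀ n, Ω n → ℝ),
        1 ≤ d → (∀ n, IsRandomSplit (P n) d (D n) (IP n) (p n) (v n) (α n)) →
        Tendsto D atTop atTop →
        TendstoInDistribution (fun n ω => √((D n : ℝ) - 1 / 2) * Real.sin (α n ω)) atTop
          id P (chiMeasure d) ∧
        TendstoInDistribution (fun n ω => √(D n : ℝ) * Real.sin (α n ω)) atTop
          id P (chiMeasure d)) ∧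
    -- `d → ∞` and `D → ∞` with `d / D → 0`
    (∀ (d D : ℕ → ℕ) (Ω : ℕ → Type*) [∀ n, MeasurableSpace (Ω n)]
        (P : ∀ n, Measure (Ω n)) [∀ n, IsProbabilityMeasure (P n)]
        (IP : ∀ n, Ω n → AffineSubspace ℝ (EuclideanSpace ℝ (Fin (D n))))
        (p v : ∀ n, Ω n → EuclideanSpace ℝ (Fin (D n))) (α : ∀ n, Ω n → ℝ),
        (∀ n, IsRandomSplit (P n) (d n) (D n) (IP n) (p n) (v n) (α n)) →
        Tendsto d atTop atTop → Tendsto D atTop atTop →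
        Tendsto (fun n => (d n : ℝ) / (D n : ℝ)) atTop (𝓝 0) →
        TendstoInDistribution
          (fun n ω => (Real.sin (α n ω) - √((d n : ℝ) - 1 / 2) / √((D n : ℝ) - 1 / 2)) /
            √(1 / (2 * (D n : ℝ) - 1))) atTop
          id P (gaussianReal 0 1)) := by
  refine ⟨?_, ?_, ?_⟩
  · intro d D Ω _ P _ IP p v α _ h
    exact ⟨h.hasLaw_norm_starProjection, h.hasLaw_norm, h.ae_sin_eq⟩
  · intro d D Ω _ P _ IP p v α _ h hD
    exact ⟨tendstoInDistribution_sqrt_mul_sin (1 / 2) h hD,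
      by simpa only [sub_zero] using tendstoInDistribution_sqrt_mul_sin 0 h hD⟩
  · intro d D Ω _ P _ IP p v α h hd hD hdD
    exact tendstoInDistribution_sin_sub_div h hd hD hdD
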